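/- Let $0<q<1$ and let $(a;q)_m=\prod_{j=0}^{m-1}(1-aq^j)$. For integers $0\le n\le N$ and real $\alpha,\beta$ for which no denominator vanishes, the monic $q$-Hahn polynomial of degree $n$ in the variable $\bar x$ is $$\tilde Q_n(\bar x;\alpha,\beta,N|q)=\frac{(\alpha q;q)_n\,(q^{-N};q)_n}{(\alpha\beta q^{n+1};q)_n}\sum_{m=0}^{n}\frac{(q^{-n};q)_m(\alpha\beta q^{n+1};q)_m(\bar x;q)_m}{(\alpha q;q)_m(q^{-N};q)_m}\,\frac{q^m}{(q;q)_m}.$$ **Theorem 2.7.** Let $N\ge 1$ and $n\in\{1,\dots,N\}$ be integers and let $\alpha,\beta\in\mathbb R$ satisfy $0<\alpha q<1$ and $0<\beta q<1$; if $n=1$, assume moreover that $\alpha\beta q<1$. Then $\tilde Q_n(\bar x;\alpha,\beta,N|q)$ and $\tilde Q_{n-1}(\bar x;\alpha,\beta,N|q)$ have degrees $n$ and $n-1$ and only real simple zeros, denoted by $x_{n,1}<\dots<x_{n,n}$ and $x_{n-1,1}<\dots<x_{n-1,n-1}$ respectively, and the following hold. (i) If $\alpha>1$, then $\tilde Q_n(\bar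 x;\frac{\alpha}{q},\beta,N|q)$ has degree $n$ and only real simple zeros $y_{n,1}<\dots<y_{n,n}$, and $$y_{n,1}<1<x_{n,1}<x_{n-1,1}<y_{n,2}<x_{n,2}<\cdots<x_{n-1,n-1}<y_{n,n}<x_{n,n}<q^{-N}.$$ (ii) If $\beta>1$, then $\tilde Q_n(\bar x;\alpha,\frac{\beta}{q},N|q)$ has degree $n$ and only real simple zeros $z_{n,1}<\dots<z_{n,n}$, and $$1<x_{n,1}<z_{n,1}<x_{n-1,1}<x_{n,2}<z_{n,2}<\cdots<x_{n-1,n-1}<x_{n,n}<q^{-N}<z_{n,n}.$$ (For $n=1$ the chains read $y_{1,1}<1<x_{1,1}<q^{-N}$ and $1<x_{1,1}<q^{-N}<z_{1,1}$.) -/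

import Mathlib

open Polynomial

/-- The `q`-Pochhammer symbol `(a; q)_m = ∏_{j < m} (1 - a q^j)`, over any commutative ring
(used both for real numbers and for real polynomials in the variable). -/
def qPoch {R : Type*} [CommRing R] (a q : R) (m : ℕ) : R :=
  ∏ j ∈ Finset.range m, (1 - a * q ^ j)

/-- The basic hypergeometric series `_rφ_s(a; b; q, z)`, with the lists `a` (of length `r`) and
`b` (of length `s`) as upper and lower parameters. -/
noncomputable def basicHypergeometric (a b : List ℝ) (q z : ℝ) : ℝ :=
  ∑' m : ℕ, (a.map fun c => qPoch c q m).prod / (b.map fun c => qPoch c q m).prod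
    * ((-1) ^ m * q ^ m.choose 2) ^ (1 + (b.length : ℤ) - (a.length : ℤ))
    * (z ^ m / qPoch q q m)

/-- The monic `q`-Hahn polynomial in the variable `X`:
`(αq; q)_n (q^{-N}; q)_n / (αβq^{n+1}; q)_n * _3φ_2(q^{-n}, αβq^{n+1}, X; αq, q^{-N}; q, q)`,
where the series terminates after the index `m = n`. -/
noncomputable def qHahn (n : ℕ) (α β : ℝ) (N : ℕ) (q : ℝ) : ℝ[X] :=
  C (qPoch (α * q) q n * qPoch (q ^ (-(N : ℤ))) q n / qPoch (α * β * q ^ (n + 1)) q n) *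
    ∑ m ∈ Finset.range (n + 1),
      C (qPoch (q ^ (-(n : ℤ))) q m * qPoch (α * β * q ^ (n + 1)) q m
          / (qPoch (α * q) q m * qPoch (q ^ (-(N : ℤ))) q m) * (q ^ m / qPoch q q m)) *
        qPoch X (C q) m

/-- The values of `qHahn` are given by the defining `_3φ_2` series. -/
theorem qHahn_eval (n : ℕ) (α β : ℝ) (N : ℕ) (q : ℝ) (hq : 0 < q) (x : ℝ) :
    (qHahn n α β N q).eval x =
      qPoch (α * q) q n * qPoch (q ^ (-(N : ℤ))) q n / qPoch (α * β * q ^ (n + 1)) q n *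
        basicHypergeometric [q ^ (-(n : ℤ)), α * β * q ^ (n + 1), x]
          [α * q, q ^ (-(N : ℤ))] q q := by
  unfold qHahn basicHypergeometric
  rw [eval_mul, eval_C, eval_finsetSum]
  congr 1
  rw [tsum_eq_sum (s := Finset.range (n + 1))]
  · refine Finset.sum_congr rfl fun m _ => ?_
    have h : (qPoch (X : ℝ[X]) (C q) m).eval x = qPoch x q m := by
      simp [qPoch, eval_prod]
    rw [eval_mul, eval_C, h]
    simp
    ring
  · intro m hm
    have hm' : n < m := by simpa using hm
    have h : qPoch (q ^ (-(n : ℤ))) q m = 0 := by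
      refine Finset.prod_eq_zero (Finset.mem_range.mpr hm') ?_
      rw [zpow_neg, zpow_natCast, inv_mul_cancel₀ (pow_ne_zero _ hq.ne'), sub_self]
    simp only [List.map_cons, List.prod_cons, h, zero_mul, zero_div]

/-- `x 1 < x 2 < ⋯ < x n` is the list of all zeros of the real polynomial `p` of degree `n`:
all its zeros are real and simple. -/
def IsOrderedZeros (p : ℝ[X]) (n : ℕ) (x : ℕ → ℝ) : Prop :=
  p.degree = n ∧ StrictMonoOn x (Set.Icc 1 n) ∧ p.roots = (Finset.Icc 1 n).val.map x

/-!
Normalize the `q`-Hahn polynomials to take the value `1` at `1`. For `0 < αq < 1` and `βq < 1` the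
`q`-Chu–Vandermonde sum shows that the one of degree `n` has the sign of `(-1)ⁿ` at `q⁻ᴺ`. The
contiguous relation in `α` and a Christoffel-type formula for `(X - αq) Qₙ(X; αq, β)` combine to a
three-term recurrence with coefficients of the signs needed for Sturm's argument, so the zeros of
`Qₙ` and `Qₙ₋₁` lie in `(1, q⁻ᴺ)` and interlace, without any orthogonality.

Replacing `α` by `α/q` or `β` by `β/q` turns `Qₙ` into a linear combination of `Qₙ` and `Qₙ₋₁`,
whose signs at the zeros of `Qₙ` and `Qₙ₋₁` locate `n - 1` zeros. The `n`-th has left `(1, q⁻ᴺ)`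
through an endpoint: for `α/q` the value at `1` is still positive, while the leading coefficient has
changed sign; for `β/q` it is the sign at `q⁻ᴺ` that has changed, because one factor of the
`q`-Chu–Vandermonde product has become positive.
-/

section Pochhammer

variable {R : Type*} [CommRing R]

theorem qPoch_zero (a q : R) : qPoch a q 0 = 1 :=
  Finset.prod_range_zero _

theorem qPoch_succ (a q : R) (m : ℕ) : qPoch a q (m + 1) = qPoch a q m * (1 - a * q ^ m) :=
  Finset.prod_range_succ _ m

theorem qPoch_succ' (a q : R) (m : ℕ) : qPoch a q (m + 1) = (1 - a) * qPoch (a * q) q m := by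
  simp only [qPoch, Finset.prod_range_succ', pow_zero, mul_one, mul_comm (1 - a), pow_succ',
    mul_assoc]

theorem one_sub_mul_qPoch_mul (a q : R) (m : ℕ) :
    (1 - a) * qPoch (a * q) q m = qPoch a q m * (1 - a * q ^ m) := by
  rw [← qPoch_succ', qPoch_succ]

theorem eval_qPoch_X (x q : R) (m : ℕ) : (qPoch X (C q) m).eval x = qPoch x q m := by
  simp only [qPoch, eval_prod, eval_sub, eval_one, eval_mul, eval_pow, eval_X, eval_C]

theorem qPoch_ne_zero [IsDomain R] {a q : R} {m : ℕ} (h : ∀ j < m, a * q ^ j ≠ 1) :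
    qPoch a q m ≠ 0 :=
  Finset.prod_ne_zero_iff.mpr fun j hj => sub_ne_zero.mpr (h j (Finset.mem_range.mp hj)).symm

theorem degree_qPoch_X [IsDomain R] {q : R} (hq : q ≠ 0) (m : ℕ) :
    (qPoch X (C q) m).degree = m := by
  have hfactor (j : ℕ) : (1 - X * C q ^ j : R[X]).degree = 1 := by
    rw [show (1 - X * C q ^ j : R[X]) = C (-q ^ j) * X + C 1 by simp only [C_neg, C_pow, C_1]; ring]
    exact degree_linear (neg_ne_zero.mpr (pow_ne_zero j hq))
  simp only [qPoch, degree_prod, hfactor, Finset.sum_const, Finset.card_range, nsmul_one]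

theorem qPoch_inv_pow_eq_zero {K : Type*} [Field K] {q : K} (hq : q ≠ 0) {n m : ℕ} (h : n < m) :
    qPoch (q ^ n)⁻¹ q m = 0 :=
  Finset.prod_eq_zero (Finset.mem_range.mpr h) <| by
    rw [inv_mul_cancel₀ (pow_ne_zero n hq), sub_self]

end Pochhammer

section ThreePhiTwo

variable {K : Type*} [Field K]

/-- The coefficient of `(X; q)_m` in the series `₃φ₂(a, b, X; c, d; q, q)`. -/
def threePhiTwoCoeff (a b c d q : K) (m : ℕ) : K :=
  qPoch a q m * qPoch b q m / (qPoch c q m * qPoch d q m) * (q ^ m / qPoch q q m)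

/-- The series `₃φ₂(a, b, X; c, d; q, q)` truncated after the index `m = M`, as a polynomial in its
third upper parameter `X`. It is the whole series when `a = q⁻ᴹ`. -/
noncomputable def threePhiTwo (M : ℕ) (a b c d q : K) : K[X] :=
  ∑ m ∈ Finset.range (M + 1), C (threePhiTwoCoeff a b c d q m) * qPoch X (C q) m

theorem threePhiTwoCoeff_zero (a b c d q : K) : threePhiTwoCoeff a b c d q 0 = 1 := by
  simp only [threePhiTwoCoeff, qPoch_zero, pow_zero, mul_one, div_one]

theorem threePhiTwoCoeff_succ (a b : K) {c d q : K} {m : ℕ} (hc : c * q ^ m ≠ 1)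
    (hd : d * q ^ m ≠ 1) (hqm : q * q ^ m ≠ 1) :
    (1 - c * q ^ m) * (1 - d * q ^ m) * (1 - q * q ^ m) * threePhiTwoCoeff a b c d q (m + 1) =
      (1 - a * q ^ m) * (1 - b * q ^ m) * q * threePhiTwoCoeff a b c d q m := by
  have hcancel : (1 - c * q ^ m) * (1 - d * q ^ m) * (1 - q * q ^ m) *
      ((1 - c * q ^ m)⁻¹ * (1 - d * q ^ m)⁻¹ * (1 - q * q ^ m)⁻¹) = 1 := by
    rw [← mul_inv, ← mul_inv, mul_inv_cancel₀]
    simp only [ne_eq, mul_eq_zero, sub_eq_zero, hc.symm, hd.symm, hqm.symm, or_self,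
      not_false_eq_true]
  simp only [threePhiTwoCoeff, qPoch_succ, pow_succ, div_eq_mul_inv, mul_inv]
  linear_combination (1 - a * q ^ m) * (1 - b * q ^ m) * q * (qPoch a q m * qPoch b q m *
    ((qPoch c q m)⁻¹ * (qPoch d q m)⁻¹) * (q ^ m * (qPoch q q m)⁻¹)) * hcancel

theorem threePhiTwoCoeff_comm (a b c d q : K) (m : ℕ) :
    threePhiTwoCoeff a b c d q m = threePhiTwoCoeff b a c d q m := by
  rw [threePhiTwoCoeff, mul_comm (qPoch a q m), ← threePhiTwoCoeff]

theorem one_sub_mul_threePhiTwoCoeff_left (a b c d q : K) (m : ℕ) :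
    (1 - a) * threePhiTwoCoeff (a * q) b c d q m =
      (1 - a * q ^ m) * threePhiTwoCoeff a b c d q m := by
  simp only [threePhiTwoCoeff, div_eq_mul_inv]
  linear_combination qPoch b q m * (qPoch c q m * qPoch d q m)⁻¹ * (q ^ m * (qPoch q q m)⁻¹) *
    one_sub_mul_qPoch_mul a q m

theorem one_sub_mul_threePhiTwoCoeff_right (a b c d q : K) (m : ℕ) :
    (1 - b) * threePhiTwoCoeff a (b * q) c d q m =
      (1 - b * q ^ m) * threePhiTwoCoeff a b c d q m := by
  rw [threePhiTwoCoeff_comm, one_sub_mul_threePhiTwoCoeff_left, threePhiTwoCoeff_comm]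

theorem one_sub_mul_threePhiTwoCoeff_lower (a b d : K) {c q : K} (hc : ∀ j, c * q ^ j ≠ 1) (m : ℕ) :
    (1 - c) * threePhiTwoCoeff a b c d q m =
      (1 - c * q ^ m) * threePhiTwoCoeff a b (c * q) d q m := by
  have hc₀ : 1 - c ≠ 0 := sub_ne_zero.mpr (by simpa using (hc 0).symm)
  have hcm : 1 - c * q ^ m ≠ 0 := sub_ne_zero.mpr (hc m).symm
  have hshift : (qPoch (c * q) q m)⁻¹ = (qPoch c q m)⁻¹ * (1 - c * q ^ m)⁻¹ * (1 - c) := by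
    rw [← mul_inv, ← one_sub_mul_qPoch_mul, mul_inv, mul_right_comm, inv_mul_cancel₀ hc₀, one_mul]
  simp only [threePhiTwoCoeff, div_eq_mul_inv, mul_inv, hshift]
  field_simp

theorem eval_one_threePhiTwo (M : ℕ) (a b c d q : K) : (threePhiTwo M a b c d q).eval 1 = 1 := by
  simp only [threePhiTwo, eval_finsetSum, eval_mul, eval_C, eval_qPoch_X]
  rw [Finset.sum_range_succ', threePhiTwoCoeff_zero, qPoch_zero, mul_one, add_eq_right]
  exact Finset.sum_eq_zero fun m _ => by rw [qPoch_succ', sub_self, zero_mul, mul_zero]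

theorem degree_threePhiTwo {M : ℕ} {a b c d q : K} (hq : q ≠ 0)
    (hM : threePhiTwoCoeff a b c d q M ≠ 0) : (threePhiTwo M a b c d q).degree = M := by
  have htop : (C (threePhiTwoCoeff a b c d q M) * qPoch X (C q) M).degree = M := by
    rw [degree_C_mul hM, degree_qPoch_X hq]
  rw [threePhiTwo, Finset.sum_range_succ, degree_add_eq_right_of_degree_lt, htop]
  rw [htop, ← mem_degreeLT]
  refine Submodule.sum_mem _ fun m hm => ?_
  rw [← smul_eq_C_mul]
  refine Submodule.smul_mem _ _ (mem_degreeLT.mpr ?_)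
  rw [degree_qPoch_X hq]
  exact_mod_cast Finset.mem_range.mp hm

theorem inv_pow_succ_mul (n : ℕ) {q : K} (hq : q ≠ 0) : (q ^ (n + 1))⁻¹ * q = (q ^ n)⁻¹ := by
  rw [pow_succ, mul_inv, mul_assoc, inv_mul_cancel₀ hq, mul_one]

theorem threePhiTwo_succ_inv_pow (n : ℕ) (b c d : K) {q : K} (hq : q ≠ 0) :
    threePhiTwo (n + 1) (q ^ n)⁻¹ b c d q = threePhiTwo n (q ^ n)⁻¹ b c d q := by
  rw [threePhiTwo, Finset.sum_range_succ, threePhiTwoCoeff,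
    qPoch_inv_pow_eq_zero hq n.lt_succ_self]
  simp only [zero_mul, zero_div, C_0, add_zero, threePhiTwo]

theorem threePhiTwo_contiguous_upper (M : ℕ) (a b c d q : K) :
    C (b - a) * threePhiTwo M a b c d q =
      C (b * (1 - a)) * threePhiTwo M (a * q) b c d q -
        C (a * (1 - b)) * threePhiTwo M a (b * q) c d q := by
  simp only [threePhiTwo, Finset.mul_sum, ← Finset.sum_sub_distrib, ← mul_assoc, ← C_mul, ← sub_mul,
    ← C_sub]
  refine Finset.sum_congr rfl fun m _ => ?_
  congr 2
  linear_combination a * one_sub_mul_threePhiTwoCoeff_right a b c d q m -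
    b * one_sub_mul_threePhiTwoCoeff_left a b c d q m

theorem threePhiTwo_contiguous_lower (M : ℕ) (a b d : K) {c q : K} (hc : ∀ j, c * q ^ j ≠ 1) :
    C ((b - a) * (1 - c)) * threePhiTwo M a b c d q =
      C ((c - a) * (1 - b)) * threePhiTwo M a (b * q) (c * q) d q +
        C ((b - c) * (1 - a)) * threePhiTwo M (a * q) b (c * q) d q := by
  simp only [threePhiTwo, Finset.mul_sum, ← Finset.sum_add_distrib, ← mul_assoc, ← C_mul, ← add_mul,
    ← C_add]
  refine Finset.sum_congr rfl fun m _ => ?_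
  congr 2
  linear_combination (b - a) * one_sub_mul_threePhiTwoCoeff_lower a b d hc m -
    (c - a) * one_sub_mul_threePhiTwoCoeff_right a b (c * q) d q m -
    (b - c) * one_sub_mul_threePhiTwoCoeff_left a b (c * q) d q m

theorem one_sub_mul_threePhiTwoCoeff_succ (a b : K) {c d q : K} {m : ℕ}
    (hc : ∀ j, c * q ^ j ≠ 1) (hd : d * q ^ m ≠ 1) (hqm : q * q ^ m ≠ 1) :
    (1 - d * q ^ m) * (1 - q * q ^ m) * ((1 - c) * threePhiTwoCoeff a b c d q (m + 1)) =
      (1 - a) * (1 - b * q ^ m) * q * threePhiTwoCoeff (a * q) b (c * q) d q m := by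
  refine mul_left_cancel₀ (sub_ne_zero.mpr (hc m).symm) ?_
  linear_combination (1 - c) * threePhiTwoCoeff_succ a b (hc m) hd hqm +
    (1 - a * q ^ m) * (1 - b * q ^ m) * q * one_sub_mul_threePhiTwoCoeff_lower a b d hc m -
    (1 - c * q ^ m) * (1 - b * q ^ m) * q *
      one_sub_mul_threePhiTwoCoeff_left a b (c * q) d q m

theorem threePhiTwoCoeff_christoffel (a b : K) {c d q : K} {m : ℕ} (hq : q ≠ 0)
    (hc : ∀ j, c * q ^ j ≠ 1) (hd : d * q ^ m ≠ 1) (hqm : q * q ^ m ≠ 1) :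
    q * (b - a) * ((q ^ (m + 1))⁻¹ * (1 - c * q * q ^ m) *
        threePhiTwoCoeff (a * q) (b * q) (c * q) d q (m + 1) -
      (q ^ m)⁻¹ * threePhiTwoCoeff (a * q) (b * q) (c * q) d q m) =
    (1 - c) * ((d - a * q) * threePhiTwoCoeff a (b * q) c d q (m + 1) -
      (d - b * q) * threePhiTwoCoeff (a * q) b c d q (m + 1)) := by
  have hinv : q ^ (m + 1) * (q ^ (m + 1))⁻¹ = 1 := mul_inv_cancel₀ (pow_ne_zero _ hq)
  have hinv' : q ^ (m + 1) * (q ^ m)⁻¹ = q := by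
    rw [pow_succ', mul_assoc, mul_inv_cancel₀ (pow_ne_zero _ hq), mul_one]
  have hnext := threePhiTwoCoeff_succ (a * q) (b * q)
    (by simpa only [pow_succ', mul_assoc] using hc (m + 1) : c * q * q ^ m ≠ 1) hd hqm
  have hleft := one_sub_mul_threePhiTwoCoeff_succ a (b * q) hc hd hqm
  have hright := one_sub_mul_threePhiTwoCoeff_succ b (a * q) hc hd hqm
  rw [threePhiTwoCoeff_comm b, threePhiTwoCoeff_comm (b * q)] at hright
  refine mul_left_cancel₀ (mul_ne_zero (mul_ne_zero (sub_ne_zero.mpr hd.symm)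
    (sub_ne_zero.mpr hqm.symm)) (pow_ne_zero (m + 1) hq)) ?_
  linear_combination q * (b - a) * hnext - q ^ (m + 1) * (d - a * q) * hleft +
    q ^ (m + 1) * (d - b * q) * hright +
    (1 - d * q ^ m) * (1 - q * q ^ m) * q * (b - a) *
      ((1 - c * q * q ^ m) * threePhiTwoCoeff (a * q) (b * q) (c * q) d q (m + 1) * hinv -
        threePhiTwoCoeff (a * q) (b * q) (c * q) d q m * hinv')

theorem threePhiTwo_christoffel (M : ℕ) (a b : K) {c d q : K} (hq : q ≠ 0)
    (hc : ∀ j, c * q ^ j ≠ 1) (hd : ∀ j < M, d * q ^ j ≠ 1) (hqM : ∀ j < M, q * q ^ j ≠ 1) :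
    C (q * (b - a)) * (X - C c) * threePhiTwo M (a * q) (b * q) (c * q) d q =
      C (1 - c) * (C (d - a * q) * threePhiTwo M a (b * q) c d q -
        C (d - b * q) * threePhiTwo M (a * q) b c d q) -
      C (q * (b - a) * ((q ^ M)⁻¹ * threePhiTwoCoeff (a * q) (b * q) (c * q) d q M)) *
        qPoch X (C q) (M + 1) := by
  induction M with
  | zero =>
    simp only [threePhiTwo, zero_add, Finset.sum_range_one, threePhiTwoCoeff_zero, qPoch_succ,
      qPoch_zero, pow_zero, inv_one, mul_one, map_one, one_mul, map_mul, map_sub]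
    ring
  | succ M ih =>
    have hcoeff := congrArg C (threePhiTwoCoeff_christoffel a b hq hc (hd M M.lt_succ_self)
      (hqM M M.lt_succ_self))
    have hpow : C (q ^ (M + 1))⁻¹ * C q ^ (M + 1) = (1 : K[X]) := by
      rw [← C_pow, ← C_mul, inv_mul_cancel₀ (pow_ne_zero _ hq), C_1]
    have ih := ih (fun j hj => hd j (hj.trans M.lt_succ_self))
      (fun j hj => hqM j (hj.trans M.lt_succ_self))
    simp only [threePhiTwo] at ih ⊢
    simp only [Finset.sum_range_succ _ (M + 1), qPoch_succ X (C q) (M + 1)]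
    simp only [map_mul, map_sub, map_one, map_pow] at hcoeff ih ⊢
    linear_combination ih + qPoch X (C q) (M + 1) * hcoeff -
      C q * (C b - C a) * (X - C c) * C (threePhiTwoCoeff (a * q) (b * q) (c * q) d q (M + 1)) *
        qPoch X (C q) (M + 1) * hpow

theorem threePhiTwo_inv_pow_christoffel (n : ℕ) (b : K) {c d q : K} (hq : q ≠ 0)
    (hc : ∀ j, c * q ^ j ≠ 1) (hd : ∀ j ≤ n, d * q ^ j ≠ 1) (hqn : ∀ j ≤ n, q * q ^ j ≠ 1) :
    C (q * (b - (q ^ (n + 1))⁻¹)) * (X - C c) *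
        threePhiTwo n (q ^ n)⁻¹ (b * q) (c * q) d q =
      C (1 - c) * (C (d - (q ^ n)⁻¹) * threePhiTwo (n + 1) (q ^ (n + 1))⁻¹ (b * q) c d q -
        C (d - b * q) * threePhiTwo n (q ^ n)⁻¹ b c d q) := by
  have h := threePhiTwo_christoffel (n + 1) (q ^ (n + 1))⁻¹ b hq hc
    (fun j hj => hd j (Nat.lt_succ_iff.mp hj)) (fun j hj => hqn j (Nat.lt_succ_iff.mp hj))
  simp only [inv_pow_succ_mul n hq, threePhiTwo_succ_inv_pow _ _ _ _ hq] at h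
  rw [h, threePhiTwoCoeff, qPoch_inv_pow_eq_zero hq n.lt_succ_self]
  simp only [zero_mul, zero_div, mul_zero, C_0, sub_zero]

/-- The `q`-Chu–Vandermonde sum: at `X = d` the factors `(d; q)_m` cancel and a terminating `₂φ₁`
remains. -/
theorem eval_threePhiTwo_inv_pow_self (n : ℕ) (b : K) {c d q : K} (hq : q ≠ 0)
    (hc : ∀ j, c * q ^ j ≠ 1) (hd : ∀ j < n, d * q ^ j ≠ 1) (hqn : ∀ j < n, q * q ^ j ≠ 1) :
    (threePhiTwo n (q ^ n)⁻¹ b c d q).eval d * qPoch c q n =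
      ∏ j ∈ Finset.range n, (b - c * q ^ j) := by
  induction n generalizing b c with
  | zero =>
    simp only [threePhiTwo, zero_add, Finset.sum_range_one, threePhiTwoCoeff_zero, qPoch_zero,
      mul_one, eval_C, Finset.range_zero, Finset.prod_empty]
  | succ n ih =>
    obtain ⟨b, rfl⟩ : ∃ b', b = b' * q := ⟨b / q, (div_mul_cancel₀ b hq).symm⟩
    have hc' (j : ℕ) : c * q * q ^ j ≠ 1 := by
      simpa only [pow_succ', mul_assoc] using hc (j + 1)
    have hchristoffel := congrArg (eval d) <| threePhiTwo_inv_pow_christoffel n b hq hc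
      (fun j hj => hd j (Nat.lt_succ_of_le hj)) (fun j hj => hqn j (Nat.lt_succ_of_le hj))
    have hdn : (1 - c) * (d - (q ^ n)⁻¹) ≠ 0 :=
      mul_ne_zero (sub_ne_zero.mpr (by simpa using (hc 0).symm)) fun h =>
        hd n n.lt_succ_self (by rw [sub_eq_zero.mp h, inv_mul_cancel₀ (pow_ne_zero n hq)])
    have hd := fun j (hj : j < n) => hd j (hj.trans n.lt_succ_self)
    have hqn := fun j (hj : j < n) => hqn j (hj.trans n.lt_succ_self)
    have ih' := ih (b * q) hc' hd hqn
    have hprod : ∏ j ∈ Finset.range n, (b * q - c * q * q ^ j) =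
        (∏ j ∈ Finset.range n, (b - c * q ^ j)) * q ^ n := by
      simp only [mul_right_comm c q, ← sub_mul, Finset.prod_mul_distrib, Finset.prod_const,
        Finset.card_range]
    have hinv : (q ^ n)⁻¹ * q ^ n = 1 := inv_mul_cancel₀ (pow_ne_zero n hq)
    have hinv' : (q ^ (n + 1))⁻¹ * q ^ (n + 1) = 1 := inv_mul_cancel₀ (pow_ne_zero _ hq)
    simp only [eval_mul, eval_sub, eval_C, eval_X] at hchristoffel
    rw [hprod] at ih'
    rw [Finset.prod_range_succ', qPoch_succ, pow_zero, mul_one]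
    simp only [pow_succ' q, ← mul_assoc, hprod] at hchristoffel hinv' ⊢
    refine mul_left_cancel₀ hdn ?_
    linear_combination (1 - c) * q * (b - (q * q ^ n)⁻¹) * (d - c) * ih' +
      (1 - c) * (d - b * q) * (1 - c * q ^ n) * ih b hc hd hqn -
      qPoch c q n * (1 - c * q ^ n) * hchristoffel -
      q * (b - (q * q ^ n)⁻¹) * (d - c) *
        (threePhiTwo n (q ^ n)⁻¹ (b * q) (c * q) d q).eval d * one_sub_mul_qPoch_mul c q n +
      (1 - c) * (∏ j ∈ Finset.range n, (b - c * q ^ j)) * ((b * q - c) * hinv - (d - c) * hinv')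

end ThreePhiTwo

section RealRooted

variable {p : ℝ[X]} {n : ℕ} {x : ℕ → ℝ}

theorem isOrderedZeros_C_mul_iff {c : ℝ} (hc : c ≠ 0) :
    IsOrderedZeros (C c * p) n x ↔ IsOrderedZeros p n x := by
  rw [IsOrderedZeros, degree_C_mul hc, roots_C_mul p hc, ← IsOrderedZeros]

theorem isOrderedZeros_of_eval_eq_zero (hp : p.degree = n) (hx : StrictMonoOn x (Set.Icc 1 n))
    (hroot : ∀ j ∈ Set.Icc 1 n, p.eval (x j) = 0) : IsOrderedZeros p n x := by
  refine ⟨hp, hx, (Multiset.eq_of_le_of_card_le ?_ ?_).symm⟩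
  · have hnodup : ((Finset.Icc 1 n).val.map x).Nodup :=
      Multiset.Nodup.map_on (fun i hi j hj => hx.injOn (Finset.mem_Icc.mp hi)
        (Finset.mem_Icc.mp hj)) (Finset.Icc 1 n).nodup
    refine (Multiset.le_iff_subset hnodup).mpr fun t ht => ?_
    obtain ⟨j, hj, rfl⟩ := Multiset.mem_map.mp ht
    refine (mem_roots ?_).mpr (hroot j (Finset.mem_Icc.mp hj))
    rintro rfl
    exact WithBot.bot_ne_coe (degree_zero.symm.trans hp)
  · simpa [natDegree_eq_of_degree_eq_some hp] using p.card_roots'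

theorem exists_isOrderedZeros (hp : p.degree = n) {l r : ℕ → ℝ} (hlr : ∀ j < n, l j < r j)
    (hrl : ∀ j, j + 1 < n → r j ≤ l (j + 1))
    (hsign : ∀ j < n, p.eval (l j) * p.eval (r j) < 0) :
    ∃ y, IsOrderedZeros p n y ∧ ∀ j < n, y (j + 1) ∈ Set.Ioo (l j) (r j) := by
  have hroot (j : ℕ) (hj : j < n) : ∃ t ∈ Set.Ioo (l j) (r j), p.eval t = 0 := by
    rcases mul_neg_iff.mp (hsign j hj) with ⟨hl, hr⟩ | ⟨hl, hr⟩
    · exact intermediate_value_Ioo' (hlr j hj).le p.continuousOn ⟨hr, hl⟩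
    · exact intermediate_value_Ioo (hlr j hj).le p.continuousOn ⟨hl, hr⟩
  choose! t ht hzero using hroot
  refine ⟨fun j => t (j - 1), isOrderedZeros_of_eval_eq_zero hp ?_ fun j hj => ?_,
    fun j hj => ht j hj⟩
  · refine strictMonoOn_of_lt_add_one Set.ordConnected_Icc fun j _ hj hj' => ?_
    obtain ⟨i, rfl⟩ := Nat.exists_eq_add_of_le' hj.1
    exact ((ht i hj.2).2.trans_le (hrl i hj'.2)).trans (ht (i + 1) hj'.2).1
  · exact hzero (j - 1) (Nat.sub_one_lt_of_le hj.1 hj.2)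

namespace IsOrderedZeros

theorem eval_eq_zero (h : IsOrderedZeros p n x) {j : ℕ} (hj : j ∈ Set.Icc 1 n) :
    p.eval (x j) = 0 :=
  (mem_roots'.mp (h.2.2 ▸ Multiset.mem_map_of_mem x (Finset.mem_Icc.mpr hj))).2

theorem eval_eq_prod (h : IsOrderedZeros p n x) (t : ℝ) :
    p.eval t = p.leadingCoeff * ∏ j ∈ Finset.Icc 1 n, (t - x j) := by
  have hcard : p.roots.card = p.natDegree := by
    simp [h.2.2, natDegree_eq_of_degree_eq_some h.1]
  conv_lhs => rw [← C_leadingCoeff_mul_prod_multiset_X_sub_C hcard, h.2.2]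
  rw [Multiset.map_map, ← Finset.prod_eq_multiset_prod, eval_mul, eval_C, eval_prod]
  simp only [Function.comp_apply, eval_sub, eval_X, eval_C]

theorem sign_eval (h : IsOrderedZeros p n x) {L t : ℝ} {k : ℕ} (hpL : 0 < p.eval L)
    (hL : 1 ≤ n → L < x 1) (hkn : k ≤ n) (hlt : 1 ≤ k → x k < t) (hgt : k < n → t < x (k + 1)) :
    0 < (-1) ^ k * p.eval t := by
  have hsign : ∏ j ∈ Finset.Icc 1 n, (if j ≤ k then -1 else 1 : ℝ) = (-1) ^ k := by
    have hfilter : (Finset.Icc 1 n).filter (· ≤ k) = Finset.Icc 1 k := by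
      ext j; simp only [Finset.mem_filter, Finset.mem_Icc]; omega
    rw [Finset.prod_ite, hfilter, Finset.prod_const, Finset.prod_const_one, mul_one, Nat.card_Icc,
      Nat.add_sub_cancel]
  have hfactor : 0 < ∏ j ∈ Finset.Icc 1 n, (if j ≤ k then -1 else 1) * ((L - x j) * (t - x j)) := by
    refine Finset.prod_pos fun j hj => ?_
    obtain ⟨hj1, hjn⟩ := Finset.mem_Icc.mp hj
    have hLj : L - x j < 0 := sub_neg.mpr <|
      (hL (hj1.trans hjn)).trans_le (h.2.1.monotoneOn ⟨le_rfl, hj1.trans hjn⟩ ⟨hj1, hjn⟩ hj1)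
    split_ifs with hjk
    · have : x j < t :=
        (h.2.1.monotoneOn ⟨hj1, hjn⟩ ⟨hj1.trans hjk, hkn⟩ hjk).trans_lt (hlt (hj1.trans hjk))
      nlinarith
    · have : t < x j := (hgt (by omega)).trans_le
        (h.2.1.monotoneOn ⟨by omega, by omega⟩ ⟨hj1, hjn⟩ (by omega))
      nlinarith
  have hlead : 0 < p.leadingCoeff ^ 2 := sq_pos_of_ne_zero fun h0 => by
    rw [h.eval_eq_prod, h0, zero_mul] at hpL
    exact hpL.false
  refine (mul_pos_iff_of_pos_left hpL).mp ?_
  calc 0 < p.leadingCoeff ^ 2 *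
        ∏ j ∈ Finset.Icc 1 n, (if j ≤ k then -1 else 1) * ((L - x j) * (t - x j)) :=
        mul_pos hlead hfactor
    _ = p.eval L * ((-1) ^ k * p.eval t) := by
        rw [Finset.prod_mul_distrib, Finset.prod_mul_distrib, hsign, h.eval_eq_prod L,
          h.eval_eq_prod t]
        ring

end IsOrderedZeros

end RealRooted

section Interlacing

open Filter Topology

theorem mul_neg_of_neg_one_pow_mul_pos {k : ℕ} {u v : ℝ} (hu : 0 < (-1) ^ k * u)
    (hv : 0 < (-1) ^ (k + 1) * v) : u * v < 0 := by
  rcases neg_one_pow_eq_or ℝ k with h | h <;> rw [pow_succ, h] at hv <;> rw [h] at hu <;>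
    nlinarith

theorem eventually_const_mul_lt_const_mul {l : Filter ℝ} {f g : ℝ → ℝ} {u : ℝ} (hu : 0 < u)
    (hf : ∀ᶠ t in l, 0 < f t) (hgf : Tendsto (fun t => g t / f t) l (𝓝 0)) (v : ℝ) :
    ∀ᶠ t in l, v * g t < u * f t := by
  have hlim := hgf.const_mul v
  rw [mul_zero] at hlim
  filter_upwards [hf, hlim.eventually_lt_const hu] with t ht hlt
  rwa [← mul_div_assoc, div_lt_iff₀ ht] at hlt

/-- The zeros `w 1 < ⋯ < w n` of `Q` strictly separate the zeros `x 1 < ⋯ < x (n + 1)` of `P`. The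
polynomials need not be monic. -/
structure InterlacedZeros (P Q : ℝ[X]) (n : ℕ) (x w : ℕ → ℝ) : Prop where
  zeros_left : IsOrderedZeros P (n + 1) x
  zeros_right : IsOrderedZeros Q n w
  left_lt : ∀ j ∈ Set.Icc 1 n, x j < w j
  lt_succ : ∀ j ∈ Set.Icc 1 n, w j < x (j + 1)

namespace InterlacedZeros

variable {P Q : ℝ[X]} {n : ℕ} {x w : ℕ → ℝ} {L R u v : ℝ}

theorem degree_lt (h : InterlacedZeros P Q n x w) : Q.degree < P.degree := by
  rw [h.zeros_left.1, h.zeros_right.1]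
  exact_mod_cast n.lt_succ_self

theorem sign_left (h : InterlacedZeros P Q n x w) (hPL : 0 < P.eval L) (hL : L < x 1) {j : ℕ}
    (hj : j ∈ Set.Icc 1 n) : 0 < (-1) ^ j * P.eval (w j) :=
  h.zeros_left.sign_eval hPL (fun _ => hL) (hj.2.trans n.le_succ) (fun _ => h.left_lt j hj)
    fun _ => h.lt_succ j hj

theorem sign_right (h : InterlacedZeros P Q n x w) (hQL : 0 < Q.eval L) (hL : L < x 1) {j : ℕ}
    (hj : j ≤ n) : 0 < (-1) ^ j * Q.eval (x (j + 1)) :=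
  h.zeros_right.sign_eval hQL (fun hn => hL.trans (h.left_lt 1 ⟨le_rfl, hn⟩)) hj
    (fun hj' => h.lt_succ j ⟨hj', hj⟩) fun hj' => h.left_lt (j + 1) ⟨j.succ_pos, hj'⟩

theorem exists_eval_sub_neg (h : InterlacedZeros P Q n x w) (hPL : 0 < P.eval L) (hL : L < x 1)
    (hu : 0 < u) (v : ℝ) : ∃ M < L, (C v * Q - C u * P).eval M < 0 := by
  have hpos : ∀ᶠ t in atBot, 0 < P.eval t := by
    filter_upwards [eventually_lt_atBot L] with t ht
    simpa using h.zeros_left.sign_eval (k := 0) hPL (fun _ => hL) (Nat.zero_le _)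
      (fun h0 => absurd h0 (by simp)) fun _ => ht.trans hL
  obtain ⟨M, hlt, hML⟩ := ((eventually_const_mul_lt_const_mul hu hpos
    (div_tendsto_atBot_zero_of_degree_lt Q P h.degree_lt) v).and (eventually_lt_atBot L)).exists
  exact ⟨M, hML, by simpa using hlt⟩

theorem exists_eval_add_sign (h : InterlacedZeros P Q n x w) (hPL : 0 < P.eval L) (hL : L < x 1)
    (hR : x (n + 1) < R) (hu : 0 < u) (v : ℝ) :
    ∃ M > R, 0 < (-1) ^ (n + 1) * (C u * P + C v * Q).eval M := by
  have hpos : ∀ᶠ t in atTop, 0 < (-1) ^ (n + 1) * P.eval t := by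
    filter_upwards [eventually_gt_atTop R] with t ht
    exact h.zeros_left.sign_eval hPL (fun _ => hL) le_rfl (fun _ => hR.trans ht)
      fun h0 => absurd h0 (lt_irrefl _)
  have hlim : Tendsto (fun t => (-1) ^ (n + 1) * Q.eval t / ((-1) ^ (n + 1) * P.eval t)) atTop
      (𝓝 0) := by
    have hsign : (-1 : ℝ) ^ (n + 1) ≠ 0 := pow_ne_zero _ (neg_ne_zero.mpr one_ne_zero)
    simpa only [mul_div_mul_left _ _ hsign] using
      div_tendsto_atTop_zero_of_degree_lt Q P h.degree_lt
  obtain ⟨M, hlt, hRM⟩ := ((eventually_const_mul_lt_const_mul hu hpos hlim (-v)).and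
    (eventually_gt_atTop R)).exists
  refine ⟨M, hRM, ?_⟩
  rw [eval_add, eval_C_mul, eval_C_mul]
  linarith

theorem exists_zeros_sub (h : InterlacedZeros P Q n x w) (hPL : 0 < P.eval L) (hQL : 0 < Q.eval L)
    (hL : L < x 1) (hu : 0 < u) (hv : 0 < v) (hpL : 0 < (C v * Q - C u * P).eval L) :
    ∃ y, IsOrderedZeros (C v * Q - C u * P) (n + 1) y ∧ y 1 < L ∧
      (∀ j ∈ Set.Icc 1 (n + 1), y j < x j) ∧ ∀ j ∈ Set.Icc 1 n, w j < y (j + 1) := by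
  have hdeg : (C v * Q - C u * P).degree = (n + 1 : ℕ) := by
    rw [degree_sub_eq_right_of_degree_lt, degree_C_mul hu.ne', h.zeros_left.1]
    rw [degree_C_mul hu.ne', degree_C_mul hv.ne']
    exact h.degree_lt
  obtain ⟨M, hML, hpM⟩ := h.exists_eval_sub_neg hPL hL hu v
  obtain ⟨y, hy, hmem⟩ : ∃ y, IsOrderedZeros (C v * Q - C u * P) (n + 1) y ∧ ∀ j < n + 1,
      y (j + 1) ∈ Set.Ioo (if j = 0 then M else w j) (if j = 0 then L else x (j + 1)) := by
    refine exists_isOrderedZeros hdeg (fun j hj => ?_) (fun j hj => ?_) fun j hj => ?_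
    · split_ifs with hj0
      · exact hML
      · exact h.lt_succ j ⟨by omega, by omega⟩
    · rw [if_neg j.succ_ne_zero]
      have hlt := h.left_lt (j + 1) ⟨by omega, by omega⟩
      split_ifs with hj0
      · subst hj0
        exact (hL.trans hlt).le
      · exact hlt.le
    · split_ifs with hj0
      · exact mul_neg_of_neg_of_pos hpM hpL
      have hj' : j ∈ Set.Icc 1 n := ⟨by omega, by omega⟩
      rw [mul_comm]
      apply mul_neg_of_neg_one_pow_mul_pos (k := j)
      · rw [eval_sub, eval_C_mul, eval_C_mul, h.zeros_left.eval_eq_zero ⟨j.succ_pos, hj⟩]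
        linarith [mul_pos hv (h.sign_right hQL hL hj'.2)]
      · rw [eval_sub, eval_C_mul, eval_C_mul, h.zeros_right.eval_eq_zero hj', pow_succ]
        linarith [mul_pos hu (h.sign_left hPL hL hj')]
  have hy1 : y 1 < L := (hmem 0 n.succ_pos).2
  refine ⟨y, hy, hy1, fun j hj => ?_, fun j hj => ?_⟩
  · obtain ⟨j, rfl⟩ := Nat.exists_eq_add_of_le' hj.1
    obtain rfl | hj0 := eq_or_ne j 0
    · exact hy1.trans hL
    · simpa [hj0] using (hmem j hj.2).2
  · simpa [Nat.one_le_iff_ne_zero.mp hj.1] using (hmem j (Nat.lt_succ_of_le hj.2)).1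

theorem exists_zeros_add (h : InterlacedZeros P Q n x w) (hPL : 0 < P.eval L) (hQL : 0 < Q.eval L)
    (hL : L < x 1) (hR : x (n + 1) < R) (hu : 0 < u) (hv : 0 < v)
    (hpR : 0 < (-1) ^ n * (C u * P + C v * Q).eval R) :
    ∃ z, IsOrderedZeros (C u * P + C v * Q) (n + 1) z ∧ R < z (n + 1) ∧
      (∀ j ∈ Set.Icc 1 (n + 1), x j < z j) ∧ ∀ j ∈ Set.Icc 1 n, z j < w j := by
  have hdeg : (C u * P + C v * Q).degree = (n + 1 : ℕ) := by
    rw [degree_add_eq_left_of_degree_lt, degree_C_mul hu.ne', h.zeros_left.1]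
    rw [degree_C_mul hu.ne', degree_C_mul hv.ne']
    exact h.degree_lt
  obtain ⟨M, hRM, hpM⟩ := h.exists_eval_add_sign hPL hL hR hu v
  obtain ⟨z, hz, hmem⟩ : ∃ z, IsOrderedZeros (C u * P + C v * Q) (n + 1) z ∧ ∀ j < n + 1,
      z (j + 1) ∈ Set.Ioo (if j = n then R else x (j + 1)) (if j = n then M else w (j + 1)) := by
    refine exists_isOrderedZeros hdeg (fun j hj => ?_) (fun j hj => ?_) fun j hj => ?_
    · split_ifs with hjn
      · exact hRM
      · exact h.left_lt (j + 1) ⟨by omega, by omega⟩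
    · rw [if_neg (by omega)]
      have hlt := h.lt_succ (j + 1) ⟨by omega, by omega⟩
      split_ifs with hjn
      · subst hjn
        exact (hlt.trans hR).le
      · exact hlt.le
    · split_ifs with hjn
      · exact mul_neg_of_neg_one_pow_mul_pos hpR hpM
      have hj' : j + 1 ∈ Set.Icc 1 n := ⟨by omega, by omega⟩
      apply mul_neg_of_neg_one_pow_mul_pos (k := j)
      · rw [eval_add, eval_C_mul, eval_C_mul, h.zeros_left.eval_eq_zero ⟨j.succ_pos, hj⟩]
        linarith [mul_pos hv (h.sign_right hQL hL (Nat.le_of_succ_le hj'.2))]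
      · rw [eval_add, eval_C_mul, eval_C_mul, h.zeros_right.eval_eq_zero hj']
        linarith [mul_pos hu (h.sign_left hPL hL hj')]
  have hzR : R < z (n + 1) := by simpa using (hmem n n.lt_succ_self).1
  refine ⟨z, hz, hzR, fun j hj => ?_, fun j hj => ?_⟩
  · obtain ⟨j, rfl⟩ := Nat.exists_eq_add_of_le' hj.1
    obtain rfl | hjn := eq_or_ne j n
    · exact hR.trans hzR
    · simpa [hjn] using (hmem j hj.2).1
  · obtain ⟨j, rfl⟩ := Nat.exists_eq_add_of_le' hj.1
    simpa [(Nat.lt_of_succ_le hj.2).ne] using (hmem j (hj.2.trans n.le_succ)).2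

theorem exists_succ (h : InterlacedZeros P Q n x w) (hQL : 0 < Q.eval L)
    (hL : L < x 1) (hR : x (n + 1) < R) (hu : 0 < u) (hv : 0 < v) {A T : ℝ[X]}
    (hrec : C u * T = A * P - C v * Q) (hdeg : T.degree = (n + 2 : ℕ)) (hTL : 0 < T.eval L)
    (hTR : 0 < (-1) ^ (n + 2) * T.eval R) :
    ∃ y, InterlacedZeros T P (n + 1) y x ∧ L < y 1 ∧ y (n + 2) < R := by
  have hnode {j : ℕ} (hj : j ≤ n) : 0 < (-1) ^ (j + 1) * T.eval (x (j + 1)) := by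
    have heval := congrArg (eval (x (j + 1))) hrec
    rw [eval_sub, eval_mul, eval_mul, eval_C_mul, eval_C,
      h.zeros_left.eval_eq_zero ⟨j.succ_pos, Nat.succ_le_succ hj⟩] at heval
    refine (mul_pos_iff_of_pos_left hu).mp ?_
    calc 0 < v * ((-1) ^ j * Q.eval (x (j + 1))) := mul_pos hv (h.sign_right hQL hL hj)
      _ = u * ((-1) ^ (j + 1) * T.eval (x (j + 1))) := by
        rw [pow_succ]; linear_combination (-1) ^ j * heval
  obtain ⟨y, hy, hmem⟩ : ∃ y, IsOrderedZeros T (n + 2) y ∧ ∀ j < n + 2, y (j + 1) ∈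
      Set.Ioo (if j = 0 then L else x j) (if j = n + 1 then R else x (j + 1)) := by
    refine exists_isOrderedZeros hdeg (fun j hj => ?_) (fun j hj => ?_) fun j hj => ?_
    · split_ifs with hj0 hjn hjn
      · omega
      · rwa [hj0]
      · rwa [hjn]
      · exact h.zeros_left.2.1 ⟨by omega, by omega⟩ ⟨by omega, by omega⟩ j.lt_succ_self
    · rw [if_neg j.succ_ne_zero, if_neg (by omega)]
    · refine mul_neg_of_neg_one_pow_mul_pos (k := j) ?_ ?_ <;> split_ifs with hj0
      · rwa [hj0, pow_zero, one_mul]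
      · obtain ⟨i, rfl⟩ := Nat.exists_eq_succ_of_ne_zero hj0
        exact hnode (by omega)
      · rwa [hj0]
      · exact hnode (by omega)
  refine ⟨y, ⟨hy, h.zeros_left, fun j hj => ?_, fun j hj => ?_⟩, ?_, ?_⟩
  · obtain ⟨j, rfl⟩ := Nat.exists_eq_add_of_le' hj.1
    simpa [(Nat.lt_of_succ_le hj.2).ne] using (hmem j (hj.2.trans n.succ.le_succ)).2
  · simpa [Nat.one_le_iff_ne_zero.mp hj.1] using (hmem j (Nat.lt_succ_of_le hj.2)).1
  · simpa using (hmem 0 (by omega)).1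
  · simpa using (hmem (n + 1) (by omega)).2

end InterlacedZeros

theorem exists_interlacedZeros_of_recurrence {P : ℕ → ℝ[X]} {N : ℕ} {L R : ℝ} (hLR : L < R)
    (hdeg : ∀ k ≤ N, (P k).degree = k) (hL : ∀ k ≤ N, 0 < (P k).eval L)
    (hR : ∀ k ≤ N, 0 < (-1) ^ k * (P k).eval R)
    (hrec : ∀ k, k + 2 ≤ N → ∃ (A : ℝ[X]) (u v : ℝ), 0 < u ∧ 0 < v ∧
      C u * P (k + 2) = A * P (k + 1) - C v * P k) {n : ℕ} (hn : n + 1 ≤ N) :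
    ∃ x w, InterlacedZeros (P (n + 1)) (P n) n x w ∧ L < x 1 ∧ x (n + 1) < R := by
  induction n with
  | zero =>
    obtain ⟨x, hx, hmem⟩ := exists_isOrderedZeros (hdeg 1 hn) (l := fun _ => L) (r := fun _ => R)
      (fun _ _ => hLR) (fun j hj => absurd hj (by omega))
      fun _ _ => mul_neg_of_neg_one_pow_mul_pos (k := 0) (by simpa using hL 1 hn) (hR 1 hn)
    have hempty (j : ℕ) : j ∉ Set.Icc 1 0 := fun hj => absurd (hj.1.trans hj.2) (by omega)
    have hw : IsOrderedZeros (P 0) 0 x := isOrderedZeros_of_eval_eq_zero (hdeg 0 (Nat.zero_le N))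
      (fun j hj => absurd hj (hempty j)) fun j hj => absurd hj (hempty j)
    exact ⟨x, x, ⟨hx, hw, fun j hj => absurd hj (hempty j), fun j hj => absurd hj (hempty j)⟩,
      hmem 0 one_pos⟩
  | succ n ih =>
    have hn' : n + 1 ≤ N := n.succ.le_succ.trans hn
    obtain ⟨x, w, hxw, hLx, hxR⟩ := ih hn'
    obtain ⟨A, u, v, hu, hv, hA⟩ := hrec n hn
    obtain ⟨y, hyx, hy⟩ := hxw.exists_succ (hL n (n.le_succ.trans hn')) hLx hxR hu hv hA
      (hdeg _ hn) (hL _ hn) (hR _ hn)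
    exact ⟨y, x, hyx, hy⟩

end Interlacing

section NormalizedQHahn

theorem mul_pow_lt_one {q a : ℝ} (hq0 : 0 < q) (hq1 : q < 1) (ha : a < 1) (j : ℕ) :
    a * q ^ j < 1 := by
  have hpos := pow_pos hq0 j
  have hle := pow_le_one₀ (n := j) hq0.le hq1.le
  nlinarith

theorem mul_pow_ne_one {q a : ℝ} (hq0 : 0 < q) (hq1 : q < 1) (ha : a ≠ 1) (haq : a * q < 1)
    (j : ℕ) : a * q ^ j ≠ 1 := by
  cases j with
  | zero => rwa [pow_zero, mul_one]
  | succ j =>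
    rw [pow_succ', ← mul_assoc]
    exact (mul_pow_lt_one hq0 hq1 haq j).ne

theorem qPoch_pos {q a : ℝ} (hq0 : 0 < q) (hq1 : q < 1) (ha : a < 1) (n : ℕ) : 0 < qPoch a q n :=
  Finset.prod_pos fun j _ => sub_pos.mpr (mul_pow_lt_one hq0 hq1 ha j)

theorem inv_pow_mul_pow_ne_one {q : ℝ} (hq0 : 0 < q) (hq1 : q < 1) {n j : ℕ} (hj : j < n) :
    (q ^ n)⁻¹ * q ^ j ≠ 1 := fun h =>
  (pow_lt_pow_right_of_lt_one₀ hq0 hq1 hj).ne ((inv_mul_eq_one₀ (pow_pos hq0 n).ne').mp h)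

theorem mul_mul_pow_lt_mul_pow {q α β : ℝ} (hq0 : 0 < q) (hq1 : q < 1) (hα : 0 < α)
    (hβ : β * q < 1) {n j : ℕ} (hj : j < n) : α * β * q ^ (n + 1) < α * q * q ^ j := by
  obtain ⟨i, rfl⟩ := Nat.exists_eq_add_of_lt hj
  calc α * β * q ^ (j + i + 1 + 1) = α * q * q ^ j * (β * q * q ^ i) := by ring
    _ < α * q * q ^ j := mul_lt_of_lt_one_right (by positivity) (mul_pow_lt_one hq0 hq1 hβ i)

theorem mul_mul_pow_lt_inv_pow {q α β : ℝ} (hq0 : 0 < q) (hq1 : q < 1) (hα0 : 0 < α)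
    (hα1 : α * q < 1) (hβ : β * q < 1) {m n : ℕ} (hmn : 2 ≤ m + n) :
    α * β * q ^ m < (q ^ n)⁻¹ := by
  obtain ⟨k, hk⟩ := Nat.exists_eq_add_of_le' hmn
  have h := mul_mul_pow_lt_mul_pow hq0 hq1 hα0 hβ k.succ_pos
  rw [pow_zero, mul_one] at h
  rw [← one_div, lt_div_iff₀ (pow_pos hq0 n), mul_assoc, ← pow_add, hk]
  exact h.trans hα1

theorem mul_mul_pow_mul_pow_ne_one {q α β : ℝ} (hq0 : 0 < q) (hq1 : q < 1) (hα0 : 0 < α)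
    (hα1 : α * q < 1) (hβ : β * q < 1) {n j : ℕ} (hj : j < n) :
    α * β * q ^ (n + 1) * q ^ j ≠ 1 := by
  have h := mul_mul_pow_lt_mul_pow hq0 hq1 hα0 hβ (Nat.zero_lt_of_lt hj)
  rw [pow_zero, mul_one] at h
  exact (mul_pow_lt_one hq0 hq1 (h.trans hα1) j).ne

theorem one_lt_inv_pow {q : ℝ} (hq0 : 0 < q) (hq1 : q < 1) {n : ℕ} (hn : n ≠ 0) :
    1 < (q ^ n)⁻¹ :=
  (one_lt_inv₀ (pow_pos hq0 n)).mpr (pow_lt_one₀ hq0.le hq1 hn)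

theorem div_mul_mul_pow_succ {q : ℝ} (hq : q ≠ 0) (α β : ℝ) (n : ℕ) :
    α / q * β * q ^ (n + 1) = α * β * q ^ n := by
  rw [pow_succ]
  field_simp

theorem mul_div_mul_pow_succ {q : ℝ} (hq : q ≠ 0) (α β : ℝ) (n : ℕ) :
    α * (β / q) * q ^ (n + 1) = α * β * q ^ n := by
  rw [mul_comm α, div_mul_mul_pow_succ hq, mul_comm β]

/-- The `q`-Hahn polynomial of degree `n`, normalized to take the value `1` at `1`. -/
noncomputable def normalizedQHahn (n : ℕ) (α β : ℝ) (N : ℕ) (q : ℝ) : ℝ[X] :=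
  threePhiTwo n (q ^ n)⁻¹ (α * β * q ^ (n + 1)) (α * q) (q ^ N)⁻¹ q

theorem eval_one_normalizedQHahn (n : ℕ) (α β : ℝ) (N : ℕ) (q : ℝ) :
    (normalizedQHahn n α β N q).eval 1 = 1 :=
  eval_one_threePhiTwo _ _ _ _ _ _

theorem normalizedQHahn_mul_left (n : ℕ) (α β : ℝ) (N : ℕ) {q : ℝ} (hq : q ≠ 0)
    (hα : ∀ j, α * q * q ^ j ≠ 1) :
    C (((q ^ (n + 1))⁻¹ - α * β * q ^ (n + 2)) * (1 - α * q)) * normalizedQHahn (n + 1) α β N q =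
      C (((q ^ (n + 1))⁻¹ - α * q) * (1 - α * β * q ^ (n + 2))) *
          normalizedQHahn (n + 1) (α * q) β N q -
        C ((α * q - α * β * q ^ (n + 2)) * ((q ^ (n + 1))⁻¹ - 1)) *
          normalizedQHahn n (α * q) β N q := by
  have h := threePhiTwo_contiguous_lower (n + 1) (q ^ (n + 1))⁻¹ (α * β * q ^ (n + 2)) (q ^ N)⁻¹ hα
  rw [inv_pow_succ_mul n hq, threePhiTwo_succ_inv_pow _ _ _ _ hq] at h
  rw [normalizedQHahn, normalizedQHahn, normalizedQHahn,
    show α * q * β * q ^ (n + 1 + 1) = α * β * q ^ (n + 2) * q by ring,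
    show α * q * β * q ^ (n + 1) = α * β * q ^ (n + 2) by ring]
  simp only [map_mul, map_sub, map_one] at h ⊢
  linear_combination -h

theorem normalizedQHahn_mul_right (n : ℕ) (α β : ℝ) (N : ℕ) {q : ℝ} (hq : q ≠ 0) :
    C ((q ^ (n + 1))⁻¹ - α * β * q ^ (n + 2)) * normalizedQHahn (n + 1) α β N q =
      C ((q ^ (n + 1))⁻¹ * (1 - α * β * q ^ (n + 2))) * normalizedQHahn (n + 1) α (β * q) N q +
        C (α * β * q ^ (n + 2) * ((q ^ (n + 1))⁻¹ - 1)) * normalizedQHahn n α (β * q) N q := by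
  have h := threePhiTwo_contiguous_upper (n + 1) (q ^ (n + 1))⁻¹ (α * β * q ^ (n + 2)) (α * q)
    (q ^ N)⁻¹ q
  rw [inv_pow_succ_mul n hq, threePhiTwo_succ_inv_pow _ _ _ _ hq] at h
  rw [normalizedQHahn, normalizedQHahn, normalizedQHahn,
    show α * (β * q) * q ^ (n + 1 + 1) = α * β * q ^ (n + 2) * q by ring,
    show α * (β * q) * q ^ (n + 1) = α * β * q ^ (n + 2) by ring]
  simp only [map_mul, map_sub, map_one] at h ⊢
  linear_combination -h

theorem X_sub_C_mul_normalizedQHahn {n N : ℕ} (hn : n < N) (α β : ℝ) {q : ℝ} (hq0 : 0 < q)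
    (hq1 : q < 1) (hα : ∀ j, α * q * q ^ j ≠ 1) :
    C (q * ((q ^ (n + 1))⁻¹ - α * β * q ^ (n + 1))) * (X - C (α * q)) *
        normalizedQHahn n (α * q) β N q =
      C (1 - α * q) * (C ((q ^ N)⁻¹ - α * β * q ^ (n + 2)) * normalizedQHahn n α β N q -
        C ((q ^ N)⁻¹ - (q ^ n)⁻¹) * normalizedQHahn (n + 1) α β N q) := by
  have h := threePhiTwo_inv_pow_christoffel n (α * β * q ^ (n + 1)) hq0.ne' hα
    (d := (q ^ N)⁻¹) (fun j hj => inv_pow_mul_pow_ne_one hq0 hq1 (hj.trans_lt hn))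
    fun j _ => (mul_pow_lt_one hq0 hq1 hq1 j).ne
  rw [normalizedQHahn, normalizedQHahn, normalizedQHahn,
    show α * q * β * q ^ (n + 1) = α * β * q ^ (n + 1) * q by ring,
    show α * β * q ^ (n + 1 + 1) = α * β * q ^ (n + 1) * q by ring]
  simp only [map_mul, map_sub, map_one] at h ⊢
  linear_combination -h

theorem eval_normalizedQHahn_inv_pow {n N : ℕ} (hn : n ≤ N) (α β : ℝ) {q : ℝ} (hq0 : 0 < q)
    (hq1 : q < 1) (hα : ∀ j, α * q * q ^ j ≠ 1) :
    (normalizedQHahn n α β N q).eval (q ^ N)⁻¹ * qPoch (α * q) q n =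
      ∏ j ∈ Finset.range n, (α * β * q ^ (n + 1) - α * q * q ^ j) :=
  eval_threePhiTwo_inv_pow_self n (α * β * q ^ (n + 1)) hq0.ne' hα
    (fun _ hj => inv_pow_mul_pow_ne_one hq0 hq1 (hj.trans_le hn))
    fun j _ => (mul_pow_lt_one hq0 hq1 hq1 j).ne

theorem degree_normalizedQHahn {n N : ℕ} (hn : n ≤ N) {α β q : ℝ} (hq0 : 0 < q) (hq1 : q < 1)
    (hα : ∀ j < n, α * q * q ^ j ≠ 1) (hαβ : ∀ j < n, α * β * q ^ (n + 1) * q ^ j ≠ 1) :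
    (normalizedQHahn n α β N q).degree = n := by
  refine degree_threePhiTwo hq0.ne' (mul_ne_zero (div_ne_zero (mul_ne_zero
    (qPoch_ne_zero fun j hj => inv_pow_mul_pow_ne_one hq0 hq1 hj) (qPoch_ne_zero hαβ))
    (mul_ne_zero (qPoch_ne_zero hα) (qPoch_ne_zero fun j hj => ?_)))
    (div_ne_zero (pow_ne_zero n hq0.ne') (qPoch_ne_zero fun j _ => ?_)))
  · exact inv_pow_mul_pow_ne_one hq0 hq1 (hj.trans_le hn)
  · exact (mul_pow_lt_one hq0 hq1 hq1 j).ne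

theorem isOrderedZeros_qHahn_iff {n N : ℕ} (hn : n ≤ N) {α β q : ℝ} (hq0 : 0 < q) (hq1 : q < 1)
    (hα : ∀ j < n, α * q * q ^ j ≠ 1) (hαβ : ∀ j < n, α * β * q ^ (n + 1) * q ^ j ≠ 1)
    {x : ℕ → ℝ} :
    IsOrderedZeros (qHahn n α β N q) n x ↔ IsOrderedZeros (normalizedQHahn n α β N q) n x := by
  have hN : qPoch (q ^ N)⁻¹ q n ≠ 0 :=
    qPoch_ne_zero fun j hj => inv_pow_mul_pow_ne_one hq0 hq1 (hj.trans_le hn)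
  simp only [qHahn, zpow_neg, zpow_natCast]
  exact isOrderedZeros_C_mul_iff
    (div_ne_zero (mul_ne_zero (qPoch_ne_zero hα) hN) (qPoch_ne_zero hαβ))

end NormalizedQHahn

section Zeros

variable {q α β : ℝ} {n N : ℕ}

theorem exists_normalizedQHahn_mul_left (hq0 : 0 < q) (hq1 : q < 1) (hα0 : 0 < α)
    (hα1 : α * q < 1) (hβ : β * q < 1) (n N : ℕ) :
    ∃ e u v : ℝ, 0 < u ∧ 0 < v ∧ C e * normalizedQHahn (n + 1) α β N q =
      C u * normalizedQHahn (n + 1) (α * q) β N q - C v * normalizedQHahn n (α * q) β N q := by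
  have hA : 1 < (q ^ (n + 1))⁻¹ := one_lt_inv_pow hq0 hq1 n.succ_ne_zero
  have hB : α * β * q ^ (n + 2) < α * q := by
    simpa using mul_mul_pow_lt_mul_pow hq0 hq1 hα0 hβ n.succ_pos
  exact ⟨_, _, _, mul_pos (by linarith) (by linarith), mul_pos (by linarith) (by linarith),
    normalizedQHahn_mul_left n α β N hq0.ne' fun j => (mul_pow_lt_one hq0 hq1 hα1 j).ne⟩

theorem exists_X_sub_C_mul_normalizedQHahn (hq0 : 0 < q) (hq1 : q < 1) (hα0 : 0 < α)
    (hα1 : α * q < 1) (hβ : β * q < 1) (hn : n < N) :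
    ∃ g s t : ℝ, 0 < g ∧ 0 < s ∧ 0 < t ∧
      C g * (X - C (α * q)) * normalizedQHahn n (α * q) β N q =
        C t * normalizedQHahn n α β N q - C s * normalizedQHahn (n + 1) α β N q := by
  have hg : α * β * q ^ (n + 1) < (q ^ (n + 1))⁻¹ :=
    mul_mul_pow_lt_inv_pow hq0 hq1 hα0 hα1 hβ (by omega)
  have ht : α * β * q ^ (n + 2) < (q ^ N)⁻¹ :=
    mul_mul_pow_lt_inv_pow hq0 hq1 hα0 hα1 hβ (by omega)
  have hs : (q ^ n)⁻¹ < (q ^ N)⁻¹ :=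
    inv_strictAnti₀ (pow_pos hq0 N) (pow_lt_pow_right_of_lt_one₀ hq0 hq1 hn)
  refine ⟨_, (1 - α * q) * ((q ^ N)⁻¹ - (q ^ n)⁻¹), (1 - α * q) * ((q ^ N)⁻¹ - α * β * q ^ (n + 2)),
    mul_pos hq0 (sub_pos.mpr hg), mul_pos (sub_pos.mpr hα1) (sub_pos.mpr hs),
    mul_pos (sub_pos.mpr hα1) (sub_pos.mpr ht),
    (X_sub_C_mul_normalizedQHahn hn α β hq0 hq1
      fun j => (mul_pow_lt_one hq0 hq1 hα1 j).ne).trans ?_⟩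
  rw [C_mul, C_mul]
  ring

theorem exists_normalizedQHahn_recurrence (hq0 : 0 < q) (hq1 : q < 1)
    (hα0 : 0 < α) (hα1 : α * q < 1) (hβ : β * q < 1) (hn : n + 2 ≤ N) :
    ∃ (A : ℝ[X]) (u v : ℝ), 0 < u ∧ 0 < v ∧
      C u * normalizedQHahn (n + 2) α β N q =
        A * normalizedQHahn (n + 1) α β N q - C v * normalizedQHahn n α β N q := by
  obtain ⟨e, u, v, hu, hv, hshift⟩ := exists_normalizedQHahn_mul_left hq0 hq1 hα0 hα1 hβ n N
  obtain ⟨g, s, t, hg, -, ht, hlow⟩ :=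
    exists_X_sub_C_mul_normalizedQHahn hq0 hq1 hα0 hα1 hβ (by omega : n < N)
  obtain ⟨g', s', t', hg', hs', -, hhigh⟩ :=
    exists_X_sub_C_mul_normalizedQHahn hq0 hq1 hα0 hα1 hβ (by omega : n + 1 < N)
  refine ⟨C (u * g * t' + v * g' * s) - C (g * g' * e) * (X - C (α * q)), u * g * s', v * g' * t,
    by positivity, by positivity, ?_⟩
  simp only [map_mul, map_add] at hlow hhigh ⊢
  linear_combination C u * C g * hhigh - C v * C g' * hlow +
    C g * C g' * (X - C α * C q) * hshift

theorem neg_one_pow_mul_prod_range_pos {f : ℕ → ℝ} (hf : ∀ j < n, f j < 0) :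
    0 < (-1) ^ n * ∏ j ∈ Finset.range n, f j := by
  have h : 0 < ∏ j ∈ Finset.range n, -f j :=
    Finset.prod_pos fun j hj => neg_pos.mpr (hf j (Finset.mem_range.mp hj))
  rwa [Finset.prod_neg, Finset.card_range] at h

theorem sign_eval_normalizedQHahn_inv_pow (hq0 : 0 < q) (hq1 : q < 1) (hα0 : 0 < α)
    (hα1 : α * q < 1) (hβ : β * q < 1) (hn : n ≤ N) :
    0 < (-1) ^ n * (normalizedQHahn n α β N q).eval (q ^ N)⁻¹ := by
  refine (mul_pos_iff_of_pos_right (qPoch_pos hq0 hq1 hα1 n)).mp ?_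
  rw [mul_assoc, eval_normalizedQHahn_inv_pow hn α β hq0 hq1
    fun j => (mul_pow_lt_one hq0 hq1 hα1 j).ne]
  exact neg_one_pow_mul_prod_range_pos fun j hj =>
    sub_neg.mpr (mul_mul_pow_lt_mul_pow hq0 hq1 hα0 hβ hj)

theorem sign_eval_normalizedQHahn_div_inv_pow (hq0 : 0 < q) (hq1 : q < 1) (hα0 : 0 < α)
    (hα1 : α * q < 1) (hβ0 : 1 < β) (hβ1 : β * q < 1) (hn : n + 1 ≤ N) :
    0 < (-1) ^ n * (normalizedQHahn (n + 1) α (β / q) N q).eval (q ^ N)⁻¹ := by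
  have hlast : α * q * q ^ n < α * β * q ^ (n + 1) := by
    rw [show α * q * q ^ n = α * 1 * q ^ (n + 1) by ring]
    gcongr
  refine (mul_pos_iff_of_pos_right (qPoch_pos hq0 hq1 hα1 (n + 1))).mp ?_
  rw [mul_assoc, eval_normalizedQHahn_inv_pow hn α _ hq0 hq1
    fun j => (mul_pow_lt_one hq0 hq1 hα1 j).ne, mul_div_mul_pow_succ hq0.ne',
    Finset.prod_range_succ, ← mul_assoc]
  exact mul_pos (neg_one_pow_mul_prod_range_pos fun j hj =>
    sub_neg.mpr (mul_mul_pow_lt_mul_pow hq0 hq1 hα0 hβ1 hj)) (sub_pos.mpr hlast)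

theorem exists_interlacedZeros_normalizedQHahn (hq0 : 0 < q) (hq1 : q < 1) (hα0 : 0 < α)
    (hα1 : α * q < 1) (hβ : β * q < 1) (hn : n + 1 ≤ N) :
    ∃ x w, InterlacedZeros (normalizedQHahn (n + 1) α β N q) (normalizedQHahn n α β N q) n x w ∧
      1 < x 1 ∧ x (n + 1) < (q ^ N)⁻¹ := by
  refine exists_interlacedZeros_of_recurrence (P := fun k => normalizedQHahn k α β N q) (N := N)
    (one_lt_inv_pow hq0 hq1 (by omega)) (fun k hk => ?_)
    (fun k _ => ?_) (fun k hk => sign_eval_normalizedQHahn_inv_pow hq0 hq1 hα0 hα1 hβ hk)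
    (fun k hk => exists_normalizedQHahn_recurrence hq0 hq1 hα0 hα1 hβ hk) hn
  · exact degree_normalizedQHahn hk hq0 hq1 (fun j _ => (mul_pow_lt_one hq0 hq1 hα1 j).ne)
      fun j hj => mul_mul_pow_mul_pow_ne_one hq0 hq1 hα0 hα1 hβ hj
  · rw [eval_one_normalizedQHahn]
    exact one_pos

theorem isOrderedZeros_qHahn_iff_of_mul_lt_one (hq0 : 0 < q) (hq1 : q < 1) (hα0 : 0 < α)
    (hα1 : α * q < 1) (hβ : β * q < 1) (hn : n ≤ N) {x : ℕ → ℝ} :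
    IsOrderedZeros (qHahn n α β N q) n x ↔ IsOrderedZeros (normalizedQHahn n α β N q) n x :=
  isOrderedZeros_qHahn_iff hn hq0 hq1 (fun j _ => (mul_pow_lt_one hq0 hq1 hα1 j).ne)
    fun _ hj => mul_mul_pow_mul_pow_ne_one hq0 hq1 hα0 hα1 hβ hj

theorem exists_C_mul_normalizedQHahn_div_left (hq0 : 0 < q) (hq1 : q < 1) (hα0 : 1 < α)
    (hα1 : α * q < 1) (hβ : β * q < 1) (hαβ : α * β * q ^ (n + 1) < 1) (N : ℕ) :
    ∃ e u v : ℝ, 0 < e ∧ 0 < u ∧ 0 < v ∧ C e * normalizedQHahn (n + 1) (α / q) β N q =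
      C v * normalizedQHahn n α β N q - C u * normalizedQHahn (n + 1) α β N q := by
  have hα : α / q * q = α := div_mul_cancel₀ α hq0.ne'
  have hA : 1 < (q ^ (n + 1))⁻¹ := one_lt_inv_pow hq0 hq1 n.succ_ne_zero
  have hαA : α < (q ^ (n + 1))⁻¹ := by
    rw [← one_div, lt_div_iff₀ (pow_pos hq0 _), pow_succ', ← mul_assoc]
    exact mul_pow_lt_one hq0 hq1 hα1 n
  have hBα : α * β * q ^ (n + 1) < α := by
    rw [mul_assoc, pow_succ', ← mul_assoc β]
    exact mul_lt_of_lt_one_right (by linarith) (mul_pow_lt_one hq0 hq1 hβ n)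
  have hshift := normalizedQHahn_mul_left n (α / q) β N hq0.ne' (by
    simpa only [hα] using mul_pow_ne_one hq0 hq1 hα0.ne' hα1)
  rw [hα, div_mul_mul_pow_succ hq0.ne'] at hshift
  refine ⟨((q ^ (n + 1))⁻¹ - α * β * q ^ (n + 1)) * (α - 1), _, _, mul_pos (by linarith)
    (by linarith), mul_pos (sub_pos.mpr hαA) (sub_pos.mpr hαβ), mul_pos (sub_pos.mpr hBα)
    (sub_pos.mpr hA), ?_⟩
  simp only [map_mul, map_sub, map_one] at hshift ⊢
  linear_combination -hshift

theorem exists_C_mul_normalizedQHahn_div_right (hq0 : 0 < q) (hq1 : q < 1) (hα : 0 < α)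
    (hβ : 0 < β) (hαβ : α * β * q ^ (n + 1) < 1) (N : ℕ) :
    ∃ e u v : ℝ, 0 < e ∧ 0 < u ∧ 0 < v ∧ C e * normalizedQHahn (n + 1) α (β / q) N q =
      C u * normalizedQHahn (n + 1) α β N q + C v * normalizedQHahn n α β N q := by
  have hA : 1 < (q ^ (n + 1))⁻¹ := one_lt_inv_pow hq0 hq1 n.succ_ne_zero
  have hshift := normalizedQHahn_mul_right n α (β / q) N hq0.ne'
  rw [div_mul_cancel₀ β hq0.ne', mul_div_mul_pow_succ hq0.ne'] at hshift
  exact ⟨_, _, _, sub_pos.mpr (hαβ.trans hA), mul_pos (by positivity) (sub_pos.mpr hαβ),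
    mul_pos (by positivity) (sub_pos.mpr hA), hshift⟩

theorem exists_isOrderedZeros_qHahn_div_left (hq0 : 0 < q) (hq1 : q < 1) (hα0 : 1 < α)
    (hα1 : α * q < 1) (hβ : β * q < 1) (hαβ : α * β * q ^ (n + 1) < 1)
    (hn : n + 1 ≤ N) {x w : ℕ → ℝ}
    (h : InterlacedZeros (normalizedQHahn (n + 1) α β N q) (normalizedQHahn n α β N q) n x w)
    (hx : 1 < x 1) :
    ∃ y, IsOrderedZeros (qHahn (n + 1) (α / q) β N q) (n + 1) y ∧ y 1 < 1 ∧
      (∀ j ∈ Set.Icc 1 (n + 1), y j < x j) ∧ ∀ j ∈ Set.Icc 1 n, w j < y (j + 1) := by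
  obtain ⟨e, u, v, he, hu, hv, hshift⟩ :=
    exists_C_mul_normalizedQHahn_div_left hq0 hq1 hα0 hα1 hβ hαβ N
  have hone (k : ℕ) : 0 < (normalizedQHahn k α β N q).eval 1 :=
    one_pos.trans_eq (eval_one_normalizedQHahn k α β N q).symm
  obtain ⟨y, hy, hyx⟩ := h.exists_zeros_sub (hone _) (hone _) hx hu hv (by
    rwa [← hshift, eval_C_mul, eval_one_normalizedQHahn, mul_one])
  rw [← hshift, isOrderedZeros_C_mul_iff he.ne'] at hy
  refine ⟨y, (isOrderedZeros_qHahn_iff hn hq0 hq1 (fun j _ => ?_) fun j _ => ?_).mpr hy, hyx⟩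
  · rw [div_mul_cancel₀ α hq0.ne']
    exact mul_pow_ne_one hq0 hq1 hα0.ne' hα1 j
  · rw [div_mul_mul_pow_succ hq0.ne']
    exact (mul_pow_lt_one hq0 hq1 hαβ j).ne

theorem exists_isOrderedZeros_qHahn_div_right (hq0 : 0 < q) (hq1 : q < 1) (hα0 : 0 < α)
    (hα1 : α * q < 1) (hβ0 : 1 < β) (hβ1 : β * q < 1) (hαβ : α * β * q ^ (n + 1) < 1)
    (hn : n + 1 ≤ N) {x w : ℕ → ℝ}
    (h : InterlacedZeros (normalizedQHahn (n + 1) α β N q) (normalizedQHahn n α β N q) n x w)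
    (hx : 1 < x 1) (hxN : x (n + 1) < (q ^ N)⁻¹) :
    ∃ z, IsOrderedZeros (qHahn (n + 1) α (β / q) N q) (n + 1) z ∧
      (q ^ N)⁻¹ < z (n + 1) ∧ (∀ j ∈ Set.Icc 1 (n + 1), x j < z j) ∧
      ∀ j ∈ Set.Icc 1 n, z j < w j := by
  obtain ⟨e, u, v, he, hu, hv, hshift⟩ :=
    exists_C_mul_normalizedQHahn_div_right hq0 hq1 hα0 (one_pos.trans hβ0) hαβ N
  have hone (k : ℕ) : 0 < (normalizedQHahn k α β N q).eval 1 :=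
    one_pos.trans_eq (eval_one_normalizedQHahn k α β N q).symm
  obtain ⟨z, hz, hzx⟩ := h.exists_zeros_add (hone _) (hone _) hx hxN hu hv (by
    rw [← hshift, eval_C_mul, mul_left_comm]
    exact mul_pos he (sign_eval_normalizedQHahn_div_inv_pow hq0 hq1 hα0 hα1 hβ0 hβ1 hn))
  rw [← hshift, isOrderedZeros_C_mul_iff he.ne'] at hz
  refine ⟨z, (isOrderedZeros_qHahn_iff hn hq0 hq1 (fun j _ => ?_) fun j _ => ?_).mpr hz, hzx⟩
  · exact (mul_pow_lt_one hq0 hq1 hα1 j).ne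
  · rw [mul_div_mul_pow_succ hq0.ne']
    exact (mul_pow_lt_one hq0 hq1 hαβ j).ne

end Zeros

theorem theorem2p7_general (q : ℝ) (hq0 : 0 < q) (hq1 : q < 1) (N n : ℕ) (hn1 : 1 ≤ n)
    (hnN : n ≤ N) (α β : ℝ) (hα0 : 0 < α * q) (hα1 : α * q < 1) (hβ1 : β * q < 1)
    (hn : n = 1 → α * β * q < 1) :
    ∃ x w : ℕ → ℝ,
      IsOrderedZeros (qHahn n α β N q) n x ∧
      IsOrderedZeros (qHahn (n - 1) α β N q) (n - 1) w ∧
      (1 < α → ∃ y : ℕ → ℝ, IsOrderedZeros (qHahn n (α / q) β N q) n y ∧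
        y 1 < 1 ∧ 1 < x 1 ∧
        (∀ j ∈ Finset.Icc 1 n, y j < x j) ∧
        (∀ j ∈ Finset.Icc 1 (n - 1), x j < w j ∧ w j < y (j + 1)) ∧
        x n < q ^ (-(N : ℤ))) ∧
      (1 < β → ∃ z : ℕ → ℝ, IsOrderedZeros (qHahn n α (β / q) N q) n z ∧
        1 < x 1 ∧
        (∀ j ∈ Finset.Icc 1 n, x j < z j) ∧
        (∀ j ∈ Finset.Icc 1 (n - 1), z j < w j ∧ w j < x (j + 1)) ∧
        x n < q ^ (-(N : ℤ)) ∧ q ^ (-(N : ℤ)) < z n) := by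
  obtain ⟨n, rfl⟩ := Nat.exists_eq_add_of_le' hn1
  have hα : 0 < α := (mul_pos_iff_of_pos_right hq0).mp hα0
  have hαβ : α * β * q ^ (n + 1) < 1 := by
    rcases n.eq_zero_or_pos with rfl | hpos
    · simpa using hn rfl
    · simpa using mul_mul_pow_lt_inv_pow (n := 0) hq0 hq1 hα hα1 hβ1 (by omega : 2 ≤ n + 1 + 0)
  obtain ⟨x, w, h, hx, hxN⟩ := exists_interlacedZeros_normalizedQHahn hq0 hq1 hα hα1 hβ1 hnN
  have hiff {k : ℕ} (hk : k ≤ N) {t : ℕ → ℝ} :=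
    isOrderedZeros_qHahn_iff_of_mul_lt_one hq0 hq1 hα hα1 hβ1 hk (x := t)
  simp only [Nat.add_sub_cancel, zpow_neg, zpow_natCast, Finset.mem_Icc]
  refine ⟨x, w, (hiff hnN).mpr h.zeros_left, (hiff (n.le_succ.trans hnN)).mpr h.zeros_right,
    fun hα' => ?_, fun hβ' => ?_⟩
  · obtain ⟨y, hy, hy1, hyx, hwy⟩ :=
      exists_isOrderedZeros_qHahn_div_left hq0 hq1 hα' hα1 hβ1 hαβ hnN h hx
    exact ⟨y, hy, hy1, hx, hyx, fun j hj => ⟨h.left_lt j hj, hwy j hj⟩, hxN⟩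
  · obtain ⟨z, hz, hNz, hxz, hzw⟩ :=
      exists_isOrderedZeros_qHahn_div_right hq0 hq1 hα hα1 hβ' hβ1 hαβ hnN h hx hxN
    exact ⟨z, hz, hx, hxz, fun j hj => ⟨hzw j hj, h.lt_succ j hj⟩, hxN, hNz⟩

theorem theorem2p7 (q : ℝ) (hq0 : 0 < q) (hq1 : q < 1) (N n : ℕ) (hn1 : 1 ≤ n) (hnN : n ≤ N)
    (α β : ℝ) (hα0 : 0 < α * q) (hα1 : α * q < 1) (hβ0 : 0 < β * q) (hβ1 : β * q < 1)
    (hn : n = 1 → α * β * q < 1) :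
    ∃ x w : ℕ → ℝ,
      IsOrderedZeros (qHahn n α β N q) n x ∧
      IsOrderedZeros (qHahn (n - 1) α β N q) (n - 1) w ∧
      (1 < α → ∃ y : ℕ → ℝ, IsOrderedZeros (qHahn n (α / q) β N q) n y ∧
        y 1 < 1 ∧ 1 < x 1 ∧
        (∀ j ∈ Finset.Icc 1 n, y j < x j) ∧
        (∀ j ∈ Finset.Icc 1 (n - 1), x j < w j ∧ w j < y (j + 1)) ∧
        x n < q ^ (-(N : ℤ))) ∧
      (1 < β → ∃ z : ℕ → ℝ, IsOrderedZeros (qHahn n α (β / q) N q) n z ∧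
        1 < x 1 ∧
        (∀ j ∈ Finset.Icc 1 n, x j < z j) ∧
        (∀ j ∈ Finset.Icc 1 (n - 1), z j < w j ∧ w j < x (j + 1)) ∧
        x n < q ^ (-(N : ℤ)) ∧ q ^ (-(N : ℤ)) < z n) :=
  theorem2p7_general q hq0 hq1 N n hn1 hnN α β hα0 hα1 hβ1 hn
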